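/- Let $S^1=\mathbb{R}/\mathbb{Z}$. A critical point $c$ of a $C^3$ circle homeomorphism $f$ is called non-flat if there exist $d>1$, a neighbourhood $W$ of $c$ and a $C^3$ diffeomorphism $\phi:W\to\phi(W)\subset\mathbb{R}$ with $\phi(c)=0$ such that $f(x)=f(c)+\phi(x)\,|\phi(x)|^{d-1}$ for all $x\in W$ (in a lift to $\mathbb{R}$). A multicritical circle map is an orientation-preserving $C^3$ homeomorphism of $S^1$ that has at least one and only finitely many critical points, all of which are non-flat. **Theorem (The $C^\infty$ Realization Lemma).** For every pair $(\rho,\alpha)\in\big([0,1]\setminus\mathbb{Q}\big)\times(0,1)$ there exists a $C^\infty$ multicritical circle map $f:S^1\to S^1$ with rotation number $\rho$, with a unique invariant Borel probability measure $\mu$, and with exactly two critical points $c_1\neq c_2$, such that the two connected components of $S^1\setminus\{c_1,c_2\}$ have $\mu$-measures equal to $\alpha$ and $1-\alpha$ respectively. -/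

import Mathlib

open scoped ContDiff

/-- `F` is an orientation-preserving lift to `ℝ` of the homeomorphism `f` of the circle `ℝ / ℤ`:
a continuous non-decreasing map with `F (x + 1) = F x + 1` that projects to `f`. -/
def IsCircleLift (F : CircleDeg1Lift) (f : UnitAddCircle ≃ₜ UnitAddCircle) : Prop :=
  Continuous F ∧ ∀ x : ℝ, ((F x : ℝ) : UnitAddCircle) = f (x : UnitAddCircle)

/-- A circle homeomorphism preserves orientation if it has a non-decreasing degree one lift. -/
def IsOrientationPreserving (f : UnitAddCircle ≃ₜ UnitAddCircle) : Prop :=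
  ∃ F : CircleDeg1Lift, IsCircleLift F f

/-- Two lifts of the same circle homeomorphism differ by an integer constant. -/
theorem IsCircleLift.exists_eq_add_int {F G : CircleDeg1Lift}
    {f : UnitAddCircle ≃ₜ UnitAddCircle} (hF : IsCircleLift F f) (hG : IsCircleLift G f) :
    ∃ m : ℤ, ∀ x : ℝ, F x = G x + m := by
  have key : ∀ x : ℝ, ∃ m : ℤ, (m : ℝ) = F x - G x := by
    intro x
    have h : ((F x - G x : ℝ) : UnitAddCircle) = 0 := by
      rw [AddCircle.coe_sub, hF.2 x, hG.2 x, sub_self]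
    obtain ⟨n, hn⟩ := (AddCircle.coe_eq_zero_iff (1 : ℝ)).1 h
    exact ⟨n, by simpa using hn⟩
  choose m hm using key
  have hcont : Continuous m := by
    rw [Int.isClosedEmbedding_coe_real.isEmbedding.continuous_iff]
    have : ((fun n : ℤ => (n : ℝ)) ∘ m) = fun x => F x - G x := funext hm
    rw [this]
    exact hF.1.sub hG.1
  refine ⟨m 0, fun x => ?_⟩
  have h1 : m x = m 0 := PreconnectedSpace.constant inferInstance hcont
  have h2 := hm x
  rw [h1] at h2
  linarith

open scoped Classical in
/-- The rotation number, in `[0, 1)`, of an orientation-preserving circle homeomorphism: the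
fractional part of `lim (F^n x) / n` for any lift `F` (junk value `0` if there is no such lift). -/
noncomputable def circleRotationNumber (f : UnitAddCircle ≃ₜ UnitAddCircle) : ℝ :=
  if h : IsOrientationPreserving f then Int.fract h.choose.translationNumber else 0

/-- The rotation number can be computed with any lift. -/
theorem IsCircleLift.circleRotationNumber_eq {F : CircleDeg1Lift}
    {f : UnitAddCircle ≃ₜ UnitAddCircle} (hF : IsCircleLift F f) :
    circleRotationNumber f = Int.fract F.translationNumber := by
  have h : IsOrientationPreserving f := ⟨F, hF⟩
  obtain ⟨m, hm⟩ := IsCircleLift.exists_eq_add_int h.choose_spec hF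
  have hτ : h.choose.translationNumber = F.translationNumber + m := by
    have hmul : h.choose
        = (CircleDeg1Lift.translate (Multiplicative.ofAdd (m : ℝ)) : CircleDeg1Lift) * F := by
      ext x
      rw [CircleDeg1Lift.mul_apply, CircleDeg1Lift.translate_apply, hm x, add_comm]
    rw [hmul, CircleDeg1Lift.translationNumber_mul_of_commute,
      CircleDeg1Lift.translationNumber_translate, add_comm]
    ext x
    simp [add_comm]
  rw [circleRotationNumber, dif_pos h, hτ, Int.fract_add_intCast]

/-- `f` is an orientation-preserving circle homeomorphism of class `C^n` (its lift is `C^n`). -/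
def IsContDiffCircleHomeo (n : WithTop ℕ∞) (f : UnitAddCircle ≃ₜ UnitAddCircle) : Prop :=
  ∃ F : CircleDeg1Lift, IsCircleLift F f ∧ ContDiff ℝ n (F : ℝ → ℝ)

/-- `c` is a critical point of `f`: the derivative of `f`, read in a lift, vanishes at `c`. -/
def IsCircleCriticalPoint (f : UnitAddCircle ≃ₜ UnitAddCircle) (c : UnitAddCircle) : Prop :=
  ∃ (F : CircleDeg1Lift) (x : ℝ), IsCircleLift F f ∧ (x : UnitAddCircle) = c ∧ HasDerivAt F 0 x

/-- `c` is a non-flat critical point of `f` of criticality `d > 1`: in a lift, and on a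
neighbourhood `W` of a point `x` over `c`, one has `F y = F x + φ y * |φ y| ^ (d - 1)` with `φ` a
`C^3` diffeomorphism of `W` onto its image and `φ x = 0`. -/
def IsNonFlatCriticalPoint (f : UnitAddCircle ≃ₜ UnitAddCircle) (c : UnitAddCircle) (d : ℝ) :
    Prop :=
  1 < d ∧ ∃ (F : CircleDeg1Lift) (x : ℝ) (φ : OpenPartialHomeomorph ℝ ℝ),
    IsCircleLift F f ∧ (x : UnitAddCircle) = c ∧
    x ∈ φ.source ∧ φ x = 0 ∧
    ContDiffOn ℝ 3 φ φ.source ∧ ContDiffOn ℝ 3 φ.symm φ.target ∧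
    ∀ y ∈ φ.source, F y = F x + φ y * |φ y| ^ (d - 1)

/-- A multicritical circle map: an orientation-preserving `C^3` circle homeomorphism with a finite
non-zero number of critical points, all of them non-flat. -/
def IsMulticriticalCircleMap (f : UnitAddCircle ≃ₜ UnitAddCircle) : Prop :=
  IsContDiffCircleHomeo 3 f ∧
  {c | IsCircleCriticalPoint f c}.Finite ∧ {c | IsCircleCriticalPoint f c}.Nonempty ∧
  ∀ c, IsCircleCriticalPoint f c → ∃ d : ℝ, IsNonFlatCriticalPoint f c d

/-- `μ` is the unique Borel probability measure on the circle that is invariant under `f`. -/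
def IsUniqueInvariantProbability (f : UnitAddCircle ≃ₜ UnitAddCircle)
    (μ : MeasureTheory.Measure UnitAddCircle) : Prop :=
  MeasureTheory.IsProbabilityMeasure μ ∧ μ.map f = μ ∧
  ∀ ν : MeasureTheory.Measure UnitAddCircle,
    MeasureTheory.IsProbabilityMeasure ν → ν.map f = ν → ν = μ

/-- The set of connected components of a subset `S` of the circle. -/
def circleComponents (S : Set UnitAddCircle) : Set (Set UnitAddCircle) :=
  {A | ∃ x ∈ S, A = connectedComponentIn S x}

/-- `(ρ, α)` is admissible: there is a `C^∞` multicritical circle map with rotation number `ρ`,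
a unique invariant Borel probability measure `μ`, and exactly two critical points `c₁`, `c₂`, such
that the two connected components of the complement of `{c₁, c₂}` have `μ`-measures `α` and
`1 - α`. -/
def IsAdmissiblePair (ρ α : ℝ) : Prop :=
  ∃ f : UnitAddCircle ≃ₜ UnitAddCircle,
    IsMulticriticalCircleMap f ∧ IsContDiffCircleHomeo ∞ f ∧ circleRotationNumber f = ρ ∧
    ∃ μ : MeasureTheory.Measure UnitAddCircle, IsUniqueInvariantProbability f μ ∧
    ∃ c₁ c₂ : UnitAddCircle, c₁ ≠ c₂ ∧ {c | IsCircleCriticalPoint f c} = {c₁, c₂} ∧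
    ∃ A B : Set UnitAddCircle, A ≠ B ∧ circleComponents {c₁, c₂}ᶜ = {A, B} ∧
      μ.real A = α ∧ μ.real B = 1 - α

/-! The proof uses an explicit analytic family and the intermediate value theorem. For each `a`,
`Bicubic.lift a` is a homeomorphic lift whose derivative is a positive multiple of `(sin (π x) * sin
(π (x - a))) ^ 2`; for `0 < a < 1` its critical points on the circle are `0` and `a`, both cubic.
Adding a constant `t a` makes the translation number `ρ`. Since the translation number is strictly
monotone at irrational values, `t` is continuous (`exists_continuous_shift_translationNumber_eq`).

Let `h a` be a monotone semiconjugacy of the shifted lift to translation by `ρ`. The increment `h a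
a - h a 0` is the measure of the arc from `0` to `a`. It is continuous in `a`, because orbit points
of `0` have known, dense `h`-values (`continuous_semiconj_sub`). It is `0` at `a = 0` and `1` at `a
= 1`, so it takes the value `α` in between.

Monotone semiconjugacies suffice throughout: one to the rotation determines every invariant measure,
one from the rotation produces such a measure. No conjugacy, hence no exclusion of wandering
intervals, is needed. -/

open MeasureTheory Set Filter Topology

/-! ### Unique ergodicity of irrational rotations. -/

namespace UnitAddCircle

/-- The multiples of an irrational number are dense in the circle. -/
theorem denseRange_nsmul {ρ : ℝ} (hρ : Irrational ρ) :
    DenseRange (fun n : ℕ => n • (ρ : UnitAddCircle)) :=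
  denseRange_zsmul_iff_nsmul.1 (AddCircle.denseRange_zsmul_coe_iff.2 (by simpa using hρ))

/-- Lebesgue measure is the only probability measure invariant under an irrational rotation. -/
theorem eq_volume_of_map_add_irrational {ρ : ℝ} (hρ : Irrational ρ) (ν : Measure UnitAddCircle)
    [IsProbabilityMeasure ν] (h : ν.map (fun y => (ρ : UnitAddCircle) + y) = ν) : ν = volume := by
  have hn : ∀ n : ℕ, ν.map (fun y => n • (ρ : UnitAddCircle) + y) = ν := by
    intro n
    induction n with
    | zero => simp
    | succ n ih =>
      conv_rhs => rw [← h, ← ih]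
      rw [Measure.map_map (by fun_prop) (by fun_prop)]
      congr 1
      ext y
      simp [succ_nsmul', add_assoc]
  have hall : ∀ s : UnitAddCircle, ν.map (fun y => s + y) = ν := by
    intro s
    have : IsProbabilityMeasure (ν.map (fun y => s + y)) :=
      Measure.isProbabilityMeasure_map (by fun_prop)
    refine ext_of_forall_integral_eq_of_IsFiniteMeasure fun φ => ?_
    rw [integral_map (by fun_prop) φ.continuous.aestronglyMeasurable]
    -- The integral is continuous in the translation `s` and constant on a dense orbit, so `ν` is
    -- invariant under all translations, hence Haar.
    have hc : Continuous fun s : UnitAddCircle => ∫ y, φ (s + y) ∂ν := by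
      refine continuous_of_dominated (bound := fun _ => ‖φ‖) ?_ ?_ (integrable_const _) ?_
      · exact fun s => (φ.continuous.comp (by fun_prop)).aestronglyMeasurable
      · exact fun s => .of_forall fun y => φ.norm_coe_le_norm _
      · exact .of_forall fun y => φ.continuous.comp (by fun_prop)
    have hc' : Continuous fun _ : UnitAddCircle => ∫ y, φ y ∂ν := continuous_const
    refine congrFun ((denseRange_nsmul hρ).equalizer hc hc' ?_) s
    ext n
    conv_rhs => rw [← hn n]
    simp only [Function.comp]
    rw [integral_map (by fun_prop) φ.continuous.aestronglyMeasurable]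
  have : ν.IsAddLeftInvariant := ⟨hall⟩
  have : ν.IsAddHaarMeasure := Measure.isAddHaarMeasure_of_isCompact_nonempty_interior ν univ
    isCompact_univ (by simp) (by simp) (by simp)
  have : IsProbabilityMeasure (volume : Measure UnitAddCircle) := ⟨UnitAddCircle.measure_univ⟩
  exact Measure.isAddHaarMeasure_eq_of_isProbabilityMeasure ν volume

end UnitAddCircle

/-! ### Invariant measures through monotone semiconjugacies. -/

namespace CircleDeg1Lift

/-- The circle map covered by a degree one lift. -/
noncomputable def circleMap (G : CircleDeg1Lift) : UnitAddCircle → UnitAddCircle :=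
  Function.Periodic.lift (c := (1 : ℝ)) (f := fun x : ℝ => ((G x : ℝ) : UnitAddCircle))
    (fun x => by simp)

@[simp]
theorem circleMap_coe (G : CircleDeg1Lift) (x : ℝ) :
    G.circleMap (x : UnitAddCircle) = ((G x : ℝ) : UnitAddCircle) := rfl

/-- Semiconjugacies are not known to be continuous; monotonicity on the fundamental domain `[0, 1)`
already gives measurability. -/
theorem measurable_circleMap (G : CircleDeg1Lift) : Measurable G.circleMap := by
  have : G.circleMap = fun p : UnitAddCircle =>
      ((G (AddCircle.equivIco 1 0 p : ℝ) : ℝ) : UnitAddCircle) := by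
    ext p
    rw [← circleMap_coe, AddCircle.coe_equivIco]
  rw [this]
  exact AddCircle.measurable_mk'.comp (G.monotone.measurable.comp
    (measurable_subtype_coe.comp (AddCircle.measurableEquivIco 1 0).measurable))

end CircleDeg1Lift

namespace IsCircleLift

variable {F h : CircleDeg1Lift} {f : UnitAddCircle ≃ₜ UnitAddCircle} {ρ : ℝ}

/-- A monotone semiconjugacy to an irrational rotation maps every invariant probability measure
to Lebesgue measure. -/
theorem map_circleMap_eq_volume (hF : IsCircleLift F f) (hρ : Irrational ρ)
    (hh : ∀ x, h (F x) = ρ + h x) {ν : Measure UnitAddCircle} [IsProbabilityMeasure ν]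
    (hν : ν.map f = ν) : ν.map h.circleMap = volume := by
  have : IsProbabilityMeasure (ν.map h.circleMap) :=
    Measure.isProbabilityMeasure_map h.measurable_circleMap.aemeasurable
  refine UnitAddCircle.eq_volume_of_map_add_irrational hρ _ ?_
  rw [Measure.map_map (by fun_prop) h.measurable_circleMap]
  conv_rhs => rw [← hν]
  rw [Measure.map_map h.measurable_circleMap f.continuous.measurable]
  congr 1
  ext p
  induction p using QuotientAddGroup.induction_on with | H x =>
  simp only [Function.comp]
  have e : f (x : UnitAddCircle) = ((F x : ℝ) : UnitAddCircle) := (hF.2 x).symm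
  erw [e]
  simp only [CircleDeg1Lift.circleMap_coe, hh]
  simp

/-- A monotone semiconjugacy from an irrational rotation yields an invariant measure. -/
theorem map_map_circleMap {g : CircleDeg1Lift} (hF : IsCircleLift F f)
    (hg : ∀ x, g (ρ + x) = F (g x)) :
    ((volume : Measure UnitAddCircle).map g.circleMap).map f = volume.map g.circleMap := by
  rw [Measure.map_map f.continuous.measurable g.measurable_circleMap]
  conv_rhs => rw [← map_add_left_eq_self (volume : Measure UnitAddCircle) (ρ : UnitAddCircle)]
  rw [Measure.map_map g.measurable_circleMap (by fun_prop)]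
  congr 1
  ext p
  induction p using QuotientAddGroup.induction_on with | H x =>
  change f ((g x : ℝ) : UnitAddCircle) = g.circleMap ((ρ : UnitAddCircle) + (x : UnitAddCircle))
  rw [← hF.2, ← hg, ← AddCircle.coe_add, CircleDeg1Lift.circleMap_coe]

/-- An invariant probability measure gives an arc at most the increment of the semiconjugacy. -/
theorem measure_le (hF : IsCircleLift F f) (hρ : Irrational ρ)
    (hh : ∀ x, h (F x) = ρ + h x) {ν : Measure UnitAddCircle} [IsProbabilityMeasure ν]
    (hν : ν.map f = ν) (u v : ℝ) :
    ν {p | (AddCircle.equivIco 1 0 p : ℝ) ∈ Icc u v} ≤ ENNReal.ofReal (h v - h u) := by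
  -- By monotonicity `h` sends `[u, v]` into `[h u, h v]`, whose projection lies in the closed ball
  -- about its midpoint; only this inclusion is available when `h` has jumps.
  have hsub : {p : UnitAddCircle | (AddCircle.equivIco 1 0 p : ℝ) ∈ Icc u v} ⊆
      h.circleMap ⁻¹' Metric.closedBall (((h u + h v) / 2 : ℝ) : UnitAddCircle)
        ((h v - h u) / 2) := by
    intro p hp
    have h1 := h.monotone hp.1
    have h2 := h.monotone hp.2
    rw [mem_preimage, ← AddCircle.coe_equivIco (p := (1 : ℝ)) (a := 0) (y := p),
      CircleDeg1Lift.circleMap_coe, Metric.mem_closedBall, dist_eq_norm, ← AddCircle.coe_sub]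
    refine (QuotientAddGroup.norm_mk_le_norm).trans ?_
    rw [Real.norm_eq_abs, abs_le]
    constructor <;> linarith
  refine (measure_mono hsub).trans ?_
  rw [← Measure.map_apply h.measurable_circleMap measurableSet_closedBall,
    hF.map_circleMap_eq_volume hρ hh hν, AddCircle.volume_closedBall]
  apply ENNReal.ofReal_le_ofReal
  refine (min_le_right _ _).trans (le_of_eq (by ring))

theorem measurable_equivIco :
    Measurable fun p : UnitAddCircle => (AddCircle.equivIco 1 0 p : ℝ) :=
  measurable_subtype_coe.comp (AddCircle.measurableEquivIco 1 0).measurable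

theorem equivIco_mem (p : UnitAddCircle) : (AddCircle.equivIco 1 0 p : ℝ) ∈ Ico (0 : ℝ) 1 := by
  simpa using (AddCircle.equivIco (1 : ℝ) 0 p).2

/-- The distribution function of an invariant probability measure. -/
theorem measure_equivIco_le (hF : IsCircleLift F f) (hρ : Irrational ρ)
    (hh : ∀ x, h (F x) = ρ + h x) {ν : Measure UnitAddCircle} [IsProbabilityMeasure ν]
    (hν : ν.map f = ν) {x : ℝ} (hx : x ∈ Icc (0 : ℝ) 1) :
    ν {p | (AddCircle.equivIco 1 0 p : ℝ) ≤ x} = ENNReal.ofReal (h x - h 0) := by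
  have h01 : h 1 = h 0 + 1 := by simpa using h.map_add_one 0
  have h0x := h.monotone hx.1
  have hx1 := h.monotone hx.2
  have hm : MeasurableSet {p : UnitAddCircle | (AddCircle.equivIco 1 0 p : ℝ) ≤ x} :=
    measurable_equivIco measurableSet_Iic
  have hL : ν {p | (AddCircle.equivIco 1 0 p : ℝ) ≤ x} ≤ ENNReal.ofReal (h x - h 0) :=
    (measure_mono (t := {p | (AddCircle.equivIco 1 0 p : ℝ) ∈ Icc 0 x})
      fun p hp => ⟨(equivIco_mem p).1, hp⟩).trans (hF.measure_le hρ hh hν 0 x)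
  have hU : ν {p | (AddCircle.equivIco 1 0 p : ℝ) ≤ x}ᶜ ≤ ENNReal.ofReal (h 1 - h x) :=
    (measure_mono (t := {p | (AddCircle.equivIco 1 0 p : ℝ) ∈ Icc x 1})
      fun p hp => ⟨(not_le.1 hp).le, (equivIco_mem p).2.le⟩).trans
      (hF.measure_le hρ hh hν x 1)
  refine le_antisymm hL ?_
  rw [prob_compl_eq_one_sub hm, tsub_le_iff_right] at hU
  -- The upper bounds for the two complementary arcs add up to the total mass, so both are
  -- equalities.
  have e : (1 : ENNReal) = ENNReal.ofReal (h x - h 0) + ENNReal.ofReal (h 1 - h x) := by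
    rw [← ENNReal.ofReal_add (by linarith) (by linarith), h01]
    simp
  rw [e, add_comm] at hU
  exact (ENNReal.add_le_add_iff_left ENNReal.ofReal_ne_top).1 hU

/-- Invariant measures have no atoms: this is `measure_le` on a degenerate arc. -/
theorem measure_equivIco_eq (hF : IsCircleLift F f) (hρ : Irrational ρ)
    (hh : ∀ x, h (F x) = ρ + h x) {ν : Measure UnitAddCircle} [IsProbabilityMeasure ν]
    (hν : ν.map f = ν) (x : ℝ) :
    ν {p | (AddCircle.equivIco 1 0 p : ℝ) = x} = 0 := by
  have := hF.measure_le hρ hh hν x x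
  rw [sub_self, ENNReal.ofReal_zero, nonpos_iff_eq_zero] at this
  rw [← this]
  congr 1
  ext p
  simp [le_antisymm_iff, and_comm]

/-- Invariant probability measures are unique. -/
theorem measure_unique (hF : IsCircleLift F f) (hρ : Irrational ρ)
    (hh : ∀ x, h (F x) = ρ + h x) {μ ν : Measure UnitAddCircle} [IsProbabilityMeasure μ]
    [IsProbabilityMeasure ν] (hμ : μ.map f = μ) (hν : ν.map f = ν) : ν = μ := by
  have key : ν.map (fun p : UnitAddCircle => (AddCircle.equivIco 1 0 p : ℝ)) =
      μ.map (fun p : UnitAddCircle => (AddCircle.equivIco 1 0 p : ℝ)) := by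
    have := Measure.isProbabilityMeasure_map (μ := ν) measurable_equivIco.aemeasurable
    refine Measure.ext_of_Iic _ _ fun x => ?_
    rw [Measure.map_apply measurable_equivIco measurableSet_Iic,
      Measure.map_apply measurable_equivIco measurableSet_Iic]
    change ν {p | (AddCircle.equivIco 1 0 p : ℝ) ≤ x} = μ {p | (AddCircle.equivIco 1 0 p : ℝ) ≤ x}
    rcases lt_or_ge x 0 with hx | hx
    · have : {p : UnitAddCircle | (AddCircle.equivIco 1 0 p : ℝ) ≤ x} = ∅ :=
        eq_empty_of_forall_notMem fun p hp => (hx.trans_le (equivIco_mem p).1).not_ge hp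
      simp [this]
    rcases le_or_gt x 1 with hx1 | hx1
    · rw [hF.measure_equivIco_le hρ hh hν ⟨hx, hx1⟩, hF.measure_equivIco_le hρ hh hμ ⟨hx, hx1⟩]
    · have : {p : UnitAddCircle | (AddCircle.equivIco 1 0 p : ℝ) ≤ x} = univ :=
        eq_univ_of_forall fun p => ((equivIco_mem p).2.trans hx1).le
      simp [this]
  have hid : ∀ κ : Measure UnitAddCircle,
      (κ.map (fun p : UnitAddCircle => (AddCircle.equivIco 1 0 p : ℝ))).map
        ((↑) : ℝ → UnitAddCircle) = κ := by
    intro κ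
    rw [Measure.map_map AddCircle.measurable_mk' measurable_equivIco]
    have : (((↑) : ℝ → UnitAddCircle) ∘
        fun p : UnitAddCircle => (AddCircle.equivIco 1 0 p : ℝ)) = id := by
      ext p
      simp
    rw [this, Measure.map_id]
  rw [← hid ν, key, hid μ]

theorem measureReal_arc (hF : IsCircleLift F f) (hρ : Irrational ρ)
    (hh : ∀ x, h (F x) = ρ + h x) {ν : Measure UnitAddCircle} [IsProbabilityMeasure ν]
    (hν : ν.map f = ν) {x : ℝ} (hx : x ∈ Icc (0 : ℝ) 1) :
    ν.real {p | (AddCircle.equivIco 1 0 p : ℝ) ∈ Ioo 0 x} = h x - h 0 := by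
  have h0x := h.monotone hx.1
  have e : ν {p | (AddCircle.equivIco 1 0 p : ℝ) ∈ Ioo 0 x} =
      ν {p | (AddCircle.equivIco 1 0 p : ℝ) ≤ x} := by
    refine le_antisymm (measure_mono fun p hp => hp.2.le) ?_
    have : {p : UnitAddCircle | (AddCircle.equivIco 1 0 p : ℝ) ≤ x} ⊆
        {p | (AddCircle.equivIco 1 0 p : ℝ) ∈ Ioo 0 x} ∪
        ({p | (AddCircle.equivIco 1 0 p : ℝ) = 0} ∪ {p | (AddCircle.equivIco 1 0 p : ℝ) = x}) := by
      intro p hp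
      have := (equivIco_mem p).1
      rcases this.eq_or_lt with h0 | h0
      · exact Or.inr (Or.inl h0.symm)
      rcases (show (AddCircle.equivIco 1 0 p : ℝ) ≤ x from hp).eq_or_lt with h1 | h1
      · exact Or.inr (Or.inr h1)
      · exact Or.inl ⟨h0, h1⟩
    refine (measure_mono this).trans ((measure_union_le _ _).trans ?_)
    rw [measure_union_null (hF.measure_equivIco_eq hρ hh hν 0) (hF.measure_equivIco_eq hρ hh hν x),
      add_zero]
  rw [Measure.real, e, hF.measure_equivIco_le hρ hh hν hx, ENNReal.toReal_ofReal (by linarith)]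

theorem measureReal_arc_compl (hF : IsCircleLift F f) (hρ : Irrational ρ)
    (hh : ∀ x, h (F x) = ρ + h x) {ν : Measure UnitAddCircle} [IsProbabilityMeasure ν]
    (hν : ν.map f = ν) {x : ℝ} (hx : x ∈ Icc (0 : ℝ) 1) :
    ν.real {p | (AddCircle.equivIco 1 0 p : ℝ) ∈ Ioo x 1} = 1 - (h x - h 0) := by
  have h0x := h.monotone hx.1
  have e : {p : UnitAddCircle | (AddCircle.equivIco 1 0 p : ℝ) ∈ Ioo x 1} =
      {p | (AddCircle.equivIco 1 0 p : ℝ) ≤ x}ᶜ := by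
    ext p
    simp [(equivIco_mem p).2]
  have hm : MeasurableSet {p : UnitAddCircle | (AddCircle.equivIco 1 0 p : ℝ) ≤ x} :=
    measurable_equivIco measurableSet_Iic
  rw [e, probReal_compl_eq_one_sub hm, Measure.real,
    hF.measure_equivIco_le hρ hh hν hx, ENNReal.toReal_ofReal (by linarith)]

end IsCircleLift

/-! ### Semiconjugacies and strict monotonicity of the translation number. -/

/-- The points `n * ρ + m` with `n` natural and `m` an integer are dense for irrational `ρ`. -/
theorem Irrational.exists_nat_mul_add_int_mem_Ioo {ρ : ℝ} (hρ : Irrational ρ) {a b : ℝ}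
    (hab : a < b) : ∃ (n : ℕ) (m : ℤ), n * ρ + m ∈ Ioo a b := by
  obtain ⟨n, t, ht, hn⟩ := (UnitAddCircle.denseRange_nsmul hρ).exists_mem_open
    (QuotientAddGroup.isOpenMap_coe _ isOpen_Ioo) ((nonempty_Ioo.2 hab).image
      ((↑) : ℝ → UnitAddCircle))
  have : ((t - n * ρ : ℝ) : UnitAddCircle) = 0 := by
    rw [AddCircle.coe_sub, ← nsmul_eq_mul, AddCircle.coe_nsmul, sub_eq_zero]
    exact hn
  obtain ⟨m, hm⟩ := (AddCircle.coe_eq_zero_iff (1 : ℝ)).1 this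
  refine ⟨n, m, ?_⟩
  have : n * ρ + m = t := by
    simp only [zsmul_eq_mul, mul_one] at hm
    linarith
  rwa [this]

namespace CircleDeg1Lift

section Semiconj

variable {F h : CircleDeg1Lift} {ρ : ℝ}

theorem exists_semiconj_translate (hF : Function.Bijective F) (hρ : F.translationNumber = ρ) :
    ∃ h : CircleDeg1Lift, ∀ x, h (F x) = ρ + h x :=
  semiconj_of_isUnit_of_translationNumber_eq (isUnit_iff_bijective.2 hF)
    (translate (Multiplicative.ofAdd ρ)).isUnit (by rw [hρ, translationNumber_translate])

/-- The reverse direction is obtained separately, as `h` need not be invertible. It carries Lebesgue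
measure to an invariant measure and gives recurrent points of `F`. -/
theorem exists_translate_semiconj (hF : Function.Bijective F) (hρ : F.translationNumber = ρ) :
    ∃ g : CircleDeg1Lift, ∀ x, g (ρ + x) = F (g x) :=
  semiconj_of_isUnit_of_translationNumber_eq
    (translate (Multiplicative.ofAdd ρ)).isUnit (isUnit_iff_bijective.2 hF)
    (by rw [hρ, translationNumber_translate])

theorem map_pow_of_semiconj (hh : ∀ x, h (F x) = ρ + h x) (n : ℕ) (x : ℝ) :
    h ((F ^ n) x) = n * ρ + h x := by
  induction n with
  | zero => simp
  | succ n ih =>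
    rw [pow_succ', mul_apply, hh, ih]
    push_cast
    ring

theorem pow_map_of_semiconj {g : CircleDeg1Lift} (hg : ∀ x, g (ρ + x) = F (g x)) (n : ℕ) (x : ℝ) :
    (F ^ n) (g x) = g (n * ρ + x) := by
  induction n with
  | zero => simp
  | succ n ih =>
    rw [pow_succ', mul_apply, ih, ← hg]
    congr 1
    push_cast
    ring

/-- The translation number is strictly increasing at homeomorphisms with irrational translation
number. -/
theorem translationNumber_lt_of_add_le {G : CircleDeg1Lift} (hF : Function.Bijective F)
    (hirr : Irrational F.translationNumber) {ε : ℝ} (hε : 0 < ε) (hFG : ∀ x, F x + ε ≤ G x) :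
    F.translationNumber < G.translationNumber := by
  set ρ := F.translationNumber with hρ
  obtain ⟨g, hg⟩ := exists_translate_semiconj hF hρ.symm
  -- A monotone function has only countably many discontinuities.
  obtain ⟨y, hy⟩ : ∃ y, ContinuousAt g y := by
    by_contra! H
    have := g.monotone.countable_not_continuousAt
    simp only [H, not_false_eq_true, ofPred_true] at this
    exact not_countable_univ this
  obtain ⟨δ, hδ, hgδ⟩ := Metric.continuousAt_iff.1 hy ε hε
  -- With `n * ρ + m` slightly below `0`, continuity at `y` puts `(F ^ n) (g y) + m` within `ε` of
  -- `g y`. The gain of `ε` then lifts `(G ^ n) (g y)` to at least `g y - m`, so `n` times the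
  -- translation number of `G` is at least `-m > n * ρ`.
  obtain ⟨n, m, hn⟩ := hirr.exists_nat_mul_add_int_mem_Ioo
    (show -(min δ 1) < 0 by simp [hδ])
  have h1 := hn.1
  have hδ1 := min_le_left δ 1
  have hδ2 := min_le_right δ 1
  have hn0 : n ≠ 0 := by
    rintro rfl
    simp only [CharP.cast_eq_zero, zero_mul, zero_add] at hn
    have a1 : (m : ℝ) < 0 := hn.2
    have a2 : (-1 : ℝ) < m := by linarith [hn.1]
    norm_cast at a1 a2
    omega
  have hpow : ∀ k : ℕ, ∀ x, (F ^ (k + 1)) x + ε ≤ (G ^ (k + 1)) x := by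
    intro k
    induction k with
    | zero => simpa using hFG
    | succ k ih =>
      intro x
      rw [pow_succ' F, pow_succ' G, mul_apply, mul_apply]
      exact (hFG _).trans (G.monotone (by linarith [ih x]))
  obtain ⟨k, rfl⟩ := Nat.exists_eq_succ_of_ne_zero hn0
  have hclose : dist (g ((k + 1 : ℕ) * ρ + m + y)) (g y) < ε := by
    apply hgδ
    rw [Real.dist_eq, abs_lt]
    constructor <;> linarith [hn.2]
  rw [Real.dist_eq, abs_lt, show ((k + 1 : ℕ) * ρ + m + y) = ((k + 1 : ℕ) * ρ + y) + m by ring,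
    map_add_int, ← pow_map_of_semiconj hg] at hclose
  have hG : g y + ((-m : ℤ) : ℝ) ≤ (G ^ (k + 1)) (g y) := by
    push_cast
    linarith [hpow k (g y), hclose.1]
  have := le_translationNumber_of_add_int_le _ hG
  rw [translationNumber_pow] at this
  have hlt : ((k + 1 : ℕ) : ℝ) * ρ < ((k + 1 : ℕ) : ℝ) * G.translationNumber := by
    push_cast at this hn ⊢
    linarith [hn.2]
  exact lt_of_mul_lt_mul_left hlt (by positivity)

end Semiconj

/-! ### Continuous dependence on a parameter. -/

section Family

variable {X : Type*} [TopologicalSpace X] {Φ : X → CircleDeg1Lift}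

theorem continuous_family_pow (hΦ : Continuous fun p : X × ℝ => Φ p.1 p.2) (n : ℕ) :
    Continuous fun p : X × ℝ => (Φ p.1 ^ n) p.2 := by
  induction n with
  | zero => simpa using continuous_snd
  | succ n ih =>
    simp only [pow_succ', mul_apply]
    exact hΦ.comp (continuous_fst.prodMk ih)

/-- The translation number depends continuously on the parameter of a continuous family. -/
theorem continuous_translationNumber_family (hΦ : Continuous fun p : X × ℝ => Φ p.1 p.2) :
    Continuous fun x => (Φ x).translationNumber := by
  have hΦx : ∀ (x : X) (n : ℕ), Continuous (Φ x ^ n : CircleDeg1Lift) := fun x n =>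
    (continuous_family_pow hΦ n).comp (continuous_const.prodMk continuous_id)
  refine continuous_iff_continuousAt.2 fun x₀ => tendsto_order.2 ⟨fun c hc => ?_, fun c hc => ?_⟩
  · obtain ⟨r, hr, hr'⟩ := exists_rat_btwn hc
    have hd : (0 : ℝ) < r.den := by exact_mod_cast r.den_pos
    -- For `r = p / q`, exceeding `r` means that the `q`-th iterate moves every point by more than
    -- `p`; by compactness of `[0, 1]` this is an open condition on the parameter.
    have key : ∀ x, (r : ℝ) < (Φ x).translationNumber ↔
        (r.num : ℝ) < (Φ x ^ r.den).translationNumber := fun x => by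
      rw [translationNumber_pow, Rat.cast_def, div_lt_iff₀ hd, mul_comm]
    have h := lt_map_of_int_lt_translationNumber _ ((key x₀).1 hr')
    have hev : ∀ᶠ x in 𝓝 x₀, ∀ y ∈ Icc (0 : ℝ) 1, y + r.num < (Φ x ^ r.den) y :=
      isCompact_Icc.eventually_forall_of_forall_eventually fun y _ =>
        ((by fun_prop : Continuous fun p : X × ℝ => p.2 + r.num).continuousAt).eventually_lt
          (continuous_family_pow hΦ r.den).continuousAt (h y)
    filter_upwards [hev] with x hx
    refine hr.trans ((key x).2 (lt_translationNumber_of_forall_add_lt _ (hΦx x _) fun y => ?_))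
    have := (Φ x ^ r.den).forall_map_sub_of_Icc (fun z => (r.num : ℝ) < z)
      (fun y hy => by linarith [hx y hy]) y
    linarith
  · obtain ⟨r, hr, hr'⟩ := exists_rat_btwn hc
    have hd : (0 : ℝ) < r.den := by exact_mod_cast r.den_pos
    have key : ∀ x, (Φ x).translationNumber < (r : ℝ) ↔
        (Φ x ^ r.den).translationNumber < (r.num : ℝ) := fun x => by
      rw [translationNumber_pow, Rat.cast_def, lt_div_iff₀ hd, mul_comm]
    have h := map_lt_of_translationNumber_lt_int _ ((key x₀).1 hr)
    have hev : ∀ᶠ x in 𝓝 x₀, ∀ y ∈ Icc (0 : ℝ) 1, (Φ x ^ r.den) y < y + r.num :=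
      isCompact_Icc.eventually_forall_of_forall_eventually fun y _ =>
        (continuous_family_pow hΦ r.den).continuousAt.eventually_lt
          ((by fun_prop : Continuous fun p : X × ℝ => p.2 + r.num).continuousAt) (h y)
    filter_upwards [hev] with x hx
    refine ((key x).2 (translationNumber_lt_of_forall_lt_add _ (hΦx x _) fun y => ?_)).trans hr'
    have := (Φ x ^ r.den).forall_map_sub_of_Icc (fun z => z < (r.num : ℝ))
      (fun y hy => by linarith [hx y hy]) y
    linarith

/-- In a continuous family with constant irrational translation number, the length of a moving arc
measured by the semiconjugacy to the rotation is continuous. -/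
theorem continuous_semiconj_sub {ρ : ℝ} (hρ : Irrational ρ)
    (hΦ : Continuous fun p : X × ℝ => Φ p.1 p.2) {h : X → CircleDeg1Lift}
    (hh : ∀ a x, h a (Φ a x) = ρ + h a x) {p : X → ℝ} (hp : Continuous p) :
    Continuous fun a => h a (p a) - h a 0 := by
  have hΦ0 : ∀ n : ℕ, Continuous fun a => (Φ a ^ n) 0 := fun n =>
    (continuous_family_pow hΦ n).comp (continuous_id.prodMk continuous_const)
  -- Up to `h a 0`, the values on the orbit of `0` do not depend on `a`. A strict inequality between
  -- `p a` and an orbit point persists for nearby `a`, and `h a` turns it into a bound, without any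
  -- continuity of `h a`.
  have hval : ∀ a (n : ℕ) (m : ℤ), h a ((Φ a ^ n) 0 + m) = n * ρ + m + h a 0 := by
    intro a n m
    rw [map_add_int, map_pow_of_semiconj (hh a)]
    ring
  refine continuous_iff_continuousAt.2 fun a₀ => tendsto_order.2 ⟨fun c hc => ?_, fun c hc => ?_⟩
  · obtain ⟨n, m, h1, h2⟩ := hρ.exists_nat_mul_add_int_mem_Ioo hc
    have hlt : (Φ a₀ ^ n) 0 + m < p a₀ := by
      by_contra! H
      have := (h a₀).monotone H
      rw [hval] at this
      linarith
    filter_upwards [((hΦ0 n).add_const (m : ℝ)).continuousAt.eventually_lt hp.continuousAt hlt]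
      with a ha
    have := (h a).monotone ha.le
    rw [hval] at this
    linarith
  · obtain ⟨n, m, h1, h2⟩ := hρ.exists_nat_mul_add_int_mem_Ioo hc
    have hlt : p a₀ < (Φ a₀ ^ n) 0 + m := by
      by_contra! H
      have := (h a₀).monotone H
      rw [hval] at this
      linarith
    filter_upwards [hp.continuousAt.eventually_lt ((hΦ0 n).add_const (m : ℝ)).continuousAt hlt]
      with a ha
    have := (h a).monotone ha.le
    rw [hval] at this
    linarith

/-- A degree one lift followed by a translation. -/
noncomputable def shift (Ψ : CircleDeg1Lift) (t : ℝ) : CircleDeg1Lift :=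
  (translate (Multiplicative.ofAdd t) : CircleDeg1Lift) * Ψ

@[simp]
theorem shift_apply (Ψ : CircleDeg1Lift) (t x : ℝ) : Ψ.shift t x = t + Ψ x := rfl

theorem bijective_shift {Ψ : CircleDeg1Lift} (hΨ : Function.Bijective Ψ) (t : ℝ) :
    Function.Bijective (Ψ.shift t) :=
  (Equiv.addLeft t).bijective.comp hΨ

theorem continuous_shift_family (hΦ : Continuous fun p : X × ℝ => Φ p.1 p.2) {t : X → ℝ}
    (ht : Continuous t) : Continuous fun p : X × ℝ => (Φ p.1).shift (t p.1) p.2 := by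
  simp only [shift_apply]
  exact (ht.comp continuous_fst).add hΦ

/-- A continuous family of homeomorphisms can be translated, continuously in the parameter, to
have a prescribed irrational translation number. -/
theorem exists_continuous_shift_translationNumber_eq {ρ : ℝ} (hρ : Irrational ρ)
    (hΦ : Continuous fun p : X × ℝ => Φ p.1 p.2) (hbij : ∀ a, Function.Bijective (Φ a)) :
    ∃ t : X → ℝ, Continuous t ∧ ∀ a, ((Φ a).shift (t a)).translationNumber = ρ := by
  have hcont : ∀ a, Continuous (Φ a) := fun a =>
    hΦ.comp (continuous_const.prodMk continuous_id)
  have hex : ∀ a, ∃ t, ((Φ a).shift t).translationNumber = ρ := by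
    intro a
    have hc : Continuous fun t => ((Φ a).shift t).translationNumber :=
      continuous_translationNumber_family (Φ := fun t => (Φ a).shift t)
        (by simp only [shift_apply]; exact continuous_fst.add ((hcont a).comp continuous_snd))
    -- The translation number differs from the displacement of `0` by at most `1`, so suitable
    -- shifts fall on either side of `ρ`.
    have hd : ∀ t, |t + Φ a 0 - ((Φ a).shift t).translationNumber| ≤ 1 := fun t => by
      simpa [Real.dist_eq] using ((Φ a).shift t).dist_map_zero_translationNumber_le
    have h1 := abs_le.1 (hd (ρ + 1 - Φ a 0))
    have h2 := abs_le.1 (hd (ρ - 1 - Φ a 0))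
    exact mem_range_of_exists_le_of_exists_ge hc ⟨ρ - 1 - Φ a 0, by linarith [h2.1]⟩
      ⟨ρ + 1 - Φ a 0, by linarith [h1.2]⟩
  choose t ht using hex
  have hlt : ∀ a s s', s < s' → (((Φ a).shift s).translationNumber = ρ ∨
      ((Φ a).shift s').translationNumber = ρ) →
      ((Φ a).shift s).translationNumber < ((Φ a).shift s').translationNumber := by
    intro a s s' hs h
    have hle : ((Φ a).shift s).translationNumber ≤ ((Φ a).shift s').translationNumber :=
      translationNumber_mono fun x => by simpa using hs.le
    have key : ((Φ a).shift s).translationNumber = ρ →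
        ((Φ a).shift s).translationNumber < ((Φ a).shift s').translationNumber := fun h =>
      translationNumber_lt_of_add_le (bijective_shift (hbij a) s) (h ▸ hρ) (sub_pos.2 hs)
        fun x => by simp only [shift_apply]; linarith
    rcases h with h | h
    · exact key h
    -- If only the larger shift is known to have number `ρ`, equality would give `ρ` for the smaller
    -- one too, and the first case applies.
    · rcases hle.eq_or_lt with he | he
      · exact key (he.trans h)
      · exact he
  have hc : ∀ s, Continuous fun a => ((Φ a).shift s).translationNumber := fun s =>
    continuous_translationNumber_family (continuous_shift_family hΦ (continuous_const (y := s)))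
  refine ⟨t, continuous_iff_continuousAt.2 fun a₀ => tendsto_order.2
    ⟨fun c hca => ?_, fun c hca => ?_⟩, ht⟩
  -- The fixed shift `c < t a₀` has translation number below `ρ`, also for nearby `a`, which forces
  -- `c < t a` there.
  · have h := hlt a₀ c (t a₀) hca (Or.inr (ht a₀))
    rw [ht a₀] at h
    filter_upwards [(hc c).continuousAt.eventually_lt_const h] with a ha
    by_contra! H
    have : ((Φ a).shift (t a)).translationNumber ≤ ((Φ a).shift c).translationNumber :=
      translationNumber_mono fun x => by simpa using H
    rw [ht a] at this
    linarith
  · have h := hlt a₀ (t a₀) c hca (Or.inl (ht a₀))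
    rw [ht a₀] at h
    filter_upwards [(hc c).continuousAt.eventually_const_lt h] with a ha
    by_contra! H
    have : ((Φ a).shift c).translationNumber ≤ ((Φ a).shift (t a)).translationNumber :=
      translationNumber_mono fun x => by simpa using H
    rw [ht a] at this
    linarith

end Family

end CircleDeg1Lift

/-! ### Normal form at cubic critical points. -/

/-- Near a zero of order two of its derivative, an analytic function with nonnegative derivative is
the signed cube of a local `C^3` diffeomorphism. -/
theorem AnalyticAt.exists_openPartialHomeomorph_cube {F : ℝ → ℝ} {x : ℝ} (hF : AnalyticAt ℝ F x)
    (hord : analyticOrderAt (deriv F) x = 2) (hmono : Monotone F) :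
    ∃ φ : OpenPartialHomeomorph ℝ ℝ, x ∈ φ.source ∧ φ x = 0 ∧
      ContDiffOn ℝ 3 φ φ.source ∧ ContDiffOn ℝ 3 φ.symm φ.target ∧
      ∀ y ∈ φ.source, F y = F x + φ y * |φ y| ^ ((3 : ℝ) - 1) := by
  have hord3 : analyticOrderAt (F · - F x) x = (3 : ℕ) := by
    rw [← hF.analyticOrderAt_deriv_add_one, hord]
    rfl
  obtain ⟨g, hg, hg0, hFg⟩ := (AnalyticAt.analyticOrderAt_eq_natCast (by fun_prop)).1 hord3
  have hgpos : 0 < g x := by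
    refine lt_of_le_of_ne ?_ hg0.symm
    have hev : ∀ᶠ y in 𝓝[>] x, 0 ≤ g y := by
      filter_upwards [hFg.filter_mono nhdsWithin_le_nhds, self_mem_nhdsWithin] with y hy hxy
      have hxy' : 0 < y - x := sub_pos.2 hxy
      have h1 : 0 ≤ F y - F x := sub_nonneg.2 (hmono (le_of_lt hxy))
      rw [hy, smul_eq_mul] at h1
      exact nonneg_of_mul_nonneg_right h1 (by positivity)
    exact ge_of_tendsto (hg.continuousAt.tendsto.mono_left nhdsWithin_le_nhds) hev
  -- Since `F y - F x = (y - x) ^ 3 * g y` with `g x > 0`, the cube root of `g` is smooth near `x`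
  -- and `ψ` is a local diffeomorphism with cube `F y - F x`.
  set ψ : ℝ → ℝ := fun y => (y - x) * g y ^ (1 / 3 : ℝ) with hψ
  have hgc : ContDiffAt ℝ 3 g x := hg.contDiffAt
  have hroot : ContDiffAt ℝ 3 (fun y => g y ^ (1 / 3 : ℝ)) x :=
    hgc.rpow_const_of_ne hg0
  have hψc : ContDiffAt ℝ 3 ψ x := (contDiffAt_id.sub contDiffAt_const).mul hroot
  have hψd : HasDerivAt ψ (g x ^ (1 / 3 : ℝ)) x := by
    have h1 : HasDerivAt (fun y : ℝ => y - x) 1 x := (hasDerivAt_id x).sub_const x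
    have h2 := (hroot.differentiableAt (by norm_num)).hasDerivAt
    have h3 := h1.mul h2
    simp only [sub_self, zero_mul, one_mul, add_zero] at h3
    exact h3
  have hne : g x ^ (1 / 3 : ℝ) ≠ 0 := (Real.rpow_pos_of_pos hgpos _).ne'
  set e := hψc.toOpenPartialHomeomorph ψ (hψd.hasFDerivAt_equiv hne) (by norm_num) with he
  have hex : x ∈ e.source := hψc.mem_toOpenPartialHomeomorph_source _ _
  have hcoe : ⇑e = ψ := rfl
  have hderiv : ∀ᶠ y in 𝓝 x, deriv ψ y ≠ 0 := by
    have hc : ContinuousAt (deriv ψ) x := by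
      exact (hψc.continuousAt_fderiv (by norm_num)).clm_apply continuousAt_const
    exact hc.eventually_ne (by rwa [hψd.deriv])
  have hev : ∀ᶠ y in 𝓝 x, ContDiffAt ℝ 3 ψ y ∧ deriv ψ y ≠ 0 ∧ 0 < g y ∧
      F y - F x = (y - x) ^ 3 • g y :=
    (hψc.eventually (by norm_num)).and (hderiv.and
      ((hg.continuousAt.eventually_const_lt hgpos).and hFg))
  obtain ⟨U, hU, hUo, hxU⟩ := eventually_nhds_iff.1 hev
  refine ⟨e.restrOpen U hUo, ⟨hex, hxU⟩, by simp [hcoe, hψ], ?_, ?_, ?_⟩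
  · intro y hy
    exact (hU y hy.2).1.contDiffWithinAt
  · intro z hz
    have hy := (e.restrOpen U hUo).map_target hz
    have hy2 := hU _ hy.2
    exact ((e.restrOpen U hUo).contDiffAt_symm_deriv hy2.2.1 hz
      (hy2.1.differentiableAt (by norm_num)).hasDerivAt hy2.1).contDiffWithinAt
  · intro y hy
    obtain ⟨-, -, hgy, hFy⟩ := hU y hy.2
    change F y = F x + ψ y * |ψ y| ^ ((3 : ℝ) - 1)
    have h3 : (g y ^ (1 / 3 : ℝ)) ^ 3 = g y := by
      rw [← Real.rpow_natCast, ← Real.rpow_mul hgy.le]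
      norm_num
    rw [show ((3 : ℝ) - 1) = ((2 : ℕ) : ℝ) by norm_num, Real.rpow_natCast, sq_abs]
    calc F y = F x + (y - x) ^ 3 * g y := by rw [← smul_eq_mul, ← hFy]; ring
      _ = F x + (y - x) ^ 3 * (g y ^ (1 / 3 : ℝ)) ^ 3 := by rw [h3]
      _ = _ := by simp only [hψ]; ring

/-! ### Descent of bijective lifts to circle homeomorphisms. -/

namespace CircleDeg1Lift

/-- The circle homeomorphism covered by a bijective degree one lift. -/
theorem exists_isCircleLift {F : CircleDeg1Lift} (hF : Function.Bijective F) :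
    ∃ f : UnitAddCircle ≃ₜ UnitAddCircle, IsCircleLift F f := by
  have hc : Continuous F := F.continuous_iff_surjective.2 hF.2
  have hcm : Continuous F.circleMap :=
    continuous_quot_lift _ ((AddCircle.continuous_mk' (1 : ℝ)).comp hc)
  have hbij : Function.Bijective F.circleMap := by
    constructor
    · intro p q
      induction p using QuotientAddGroup.induction_on with | H x =>
      induction q using QuotientAddGroup.induction_on with | H y =>
      intro h
      have h' : ((F x - F y : ℝ) : UnitAddCircle) = 0 := by
        rw [AddCircle.coe_sub, sub_eq_zero]
        exact h
      obtain ⟨m, hm⟩ := (AddCircle.coe_eq_zero_iff (1 : ℝ)).1 h'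
      have hxy : x = y + m := hF.1 (by
        rw [map_add_int]
        simp only [zsmul_eq_mul, mul_one] at hm
        linarith)
      rw [hxy]
      change ((y + m : ℝ) : UnitAddCircle) = (y : UnitAddCircle)
      simp
    · intro q
      induction q using QuotientAddGroup.induction_on with | H y =>
      obtain ⟨x, rfl⟩ := hF.2 y
      exact ⟨(x : UnitAddCircle), rfl⟩
  exact ⟨Continuous.homeoOfEquivCompactToT2 (f := Equiv.ofBijective _ hbij) hcm, hc, fun x => rfl⟩

end CircleDeg1Lift

/-! ### The trigonometric family with two cubic critical points. -/

namespace Bicubic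

open Real

/-- A degree one trigonometric map whose derivative is a multiple of
`(sin (π x) * sin (π (x - a))) ^ 2`. -/
noncomputable def toFun (a x : ℝ) : ℝ :=
  x - (cos (π * a) * sin (π * (2 * x - a)) / π - sin (2 * (π * (2 * x - a))) / (8 * π)) /
    (cos (π * a) ^ 2 + 1 / 2)

theorem denom_pos (a : ℝ) : 0 < cos (π * a) ^ 2 + 1 / 2 := by positivity

/-- Four times the squared sine product equals `(cos (π a) - cos (π (2 x - a))) ^ 2`, whose mean
over a period is `cos (π a) ^ 2 + 1 / 2`. Dividing by this mean makes the primitive of degree one.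
-/
theorem hasDerivAt_toFun (a x : ℝ) : HasDerivAt (toFun a)
    (4 / (cos (π * a) ^ 2 + 1 / 2) * (sin (π * x) * sin (π * (x - a))) ^ 2) x := by
  have hN := (denom_pos a).ne'
  have h1 : HasDerivAt (fun x : ℝ => π * (2 * x - a)) (π * (2 * 1)) x :=
    (((hasDerivAt_id x).const_mul 2).sub_const a).const_mul π
  have h2 := (hasDerivAt_id x).sub ((((h1.sin.const_mul (cos (π * a))).div_const π).sub
    ((h1.const_mul 2).sin.div_const (8 * π))).div_const (cos (π * a) ^ 2 + 1 / 2))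
  refine h2.congr_deriv ?_
  have hcos : cos (π * a) - cos (π * (2 * x - a)) = 2 * (sin (π * x) * sin (π * (x - a))) := by
    rw [Real.cos_sub_cos, show (π * a + π * (2 * x - a)) / 2 = π * x by ring,
      show (π * a - π * (2 * x - a)) / 2 = -(π * (x - a)) by ring, Real.sin_neg]
    ring
  have hsq : 4 * (sin (π * x) * sin (π * (x - a))) ^ 2 =
      (cos (π * a) - cos (π * (2 * x - a))) ^ 2 := by rw [hcos]; ring
  rw [div_mul_eq_mul_div, hsq, Real.cos_two_mul]
  have := Real.pi_ne_zero
  field_simp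
  ring

theorem deriv_toFun (a : ℝ) : deriv (toFun a) = fun x =>
    4 / (cos (π * a) ^ 2 + 1 / 2) * (sin (π * x) * sin (π * (x - a))) ^ 2 :=
  funext fun x => (hasDerivAt_toFun a x).deriv

theorem monotone_toFun (a : ℝ) : Monotone (toFun a) := by
  refine monotone_of_deriv_nonneg (fun x => (hasDerivAt_toFun a x).differentiableAt) fun x => ?_
  rw [deriv_toFun]
  have := denom_pos a
  positivity

/-- The lift given by `Bicubic.toFun`. -/
noncomputable def lift (a : ℝ) : CircleDeg1Lift where
  toFun := toFun a
  monotone' := monotone_toFun a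
  map_add_one' x := by
    have e : π * (2 * (x + 1) - a) = π * (2 * x - a) + 2 * π := by ring
    have e2 : 2 * (π * (2 * x - a) + 2 * π) = 2 * (π * (2 * x - a)) + 2 * π + 2 * π := by ring
    simp only [toFun]
    rw [e, e2]
    simp only [Real.sin_add_two_pi]
    ring

@[simp]
theorem coe_lift (a : ℝ) : ⇑(lift a) = toFun a := rfl

theorem analyticAt_toFun (a x : ℝ) : AnalyticAt ℝ (toFun a) x := by
  unfold toFun
  fun_prop

theorem continuous_lift : Continuous fun p : ℝ × ℝ => lift p.1 p.2 := by
  simp only [coe_lift, toFun]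
  exact continuous_snd.sub (Continuous.div (by fun_prop) (by fun_prop)
    fun p => (denom_pos p.1).ne')

theorem sin_pi_mul_eq_zero_iff (x : ℝ) : sin (π * x) = 0 ↔ (x : UnitAddCircle) = 0 := by
  rw [Real.sin_eq_zero_iff, AddCircle.coe_eq_zero_iff]
  refine exists_congr fun n => ?_
  rw [mul_comm, mul_right_inj' Real.pi_ne_zero]
  simp

theorem sin_mul_sin_eq_zero_iff (a x : ℝ) : sin (π * x) * sin (π * (x - a)) = 0 ↔
    (x : UnitAddCircle) = 0 ∨ (x : UnitAddCircle) = (a : UnitAddCircle) := by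
  rw [mul_eq_zero, sin_pi_mul_eq_zero_iff, sin_pi_mul_eq_zero_iff, AddCircle.coe_sub, sub_eq_zero]

theorem analyticOrderAt_sin {b y : ℝ} (hy : sin (π * (y - b)) = 0) :
    analyticOrderAt (fun y => sin (π * (y - b))) y = 1 := by
  refine AnalyticAt.analyticOrderAt_eq_one_of_zero_deriv_ne_zero (by fun_prop) hy ?_
  have h1 : HasDerivAt (fun y : ℝ => π * (y - b)) (π * 1) y :=
    ((hasDerivAt_id y).sub_const b).const_mul π
  rw [h1.sin.deriv]
  have hc : cos (π * (y - b)) ≠ 0 := fun h => by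
    have := Real.sin_sq_add_cos_sq (π * (y - b))
    rw [hy, h] at this
    norm_num at this
  exact mul_ne_zero hc (by simp)

theorem analyticOrderAt_sin_eq_zero {b y : ℝ} (hy : sin (π * (y - b)) ≠ 0) :
    analyticOrderAt (fun y => sin (π * (y - b))) y = 0 :=
  (AnalyticAt.analyticOrderAt_eq_zero (by fun_prop)).2 hy

theorem analyticOrderAt_deriv_toFun_eq (a x : ℝ) : analyticOrderAt (deriv (toFun a)) x =
    2 • (analyticOrderAt (fun y => sin (π * (y - 0))) x +
      analyticOrderAt (fun y => sin (π * (y - a))) x) := by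
  have hs : ∀ b, AnalyticAt ℝ (fun y => sin (π * (y - b))) x := fun b => by fun_prop
  have e : deriv (toFun a) = (fun _ => 4 / (cos (π * a) ^ 2 + 1 / 2)) *
      ((fun y => sin (π * (y - 0))) * (fun y => sin (π * (y - a)))) ^ 2 := by
    rw [deriv_toFun]
    ext y
    simp
  have h0 : analyticOrderAt (fun _ : ℝ => 4 / (cos (π * a) ^ 2 + 1 / 2)) x = 0 :=
    (AnalyticAt.analyticOrderAt_eq_zero analyticAt_const).2
      (div_pos (by norm_num) (denom_pos a)).ne'
  rw [e, analyticOrderAt_mul analyticAt_const (((hs 0).mul (hs a)).pow 2), h0, zero_add,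
    analyticOrderAt_pow ((hs 0).mul (hs a)), analyticOrderAt_mul (hs 0) (hs a)]

theorem analyticOrderAt_deriv_toFun_ne_top (a x : ℝ) :
    analyticOrderAt (deriv (toFun a)) x ≠ ⊤ := by
  rw [analyticOrderAt_deriv_toFun_eq]
  by_cases h0 : sin (π * (x - 0)) = 0 <;> by_cases ha : sin (π * (x - a)) = 0 <;>
    simp only [analyticOrderAt_sin, analyticOrderAt_sin_eq_zero, h0, ha, ne_eq,
      not_false_eq_true] <;> decide

/-- Distinct critical points keep the two sines from vanishing together, so exactly one contributes
a simple zero, which is squared. If the points merged, the order would be four. -/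
theorem analyticOrderAt_deriv_toFun {a x : ℝ} (ha : (a : UnitAddCircle) ≠ 0)
    (hx : sin (π * x) * sin (π * (x - a)) = 0) : analyticOrderAt (deriv (toFun a)) x = 2 := by
  have hne : ¬ (sin (π * (x - 0)) = 0 ∧ sin (π * (x - a)) = 0) := by
    rw [sub_zero, sin_pi_mul_eq_zero_iff, sin_pi_mul_eq_zero_iff, AddCircle.coe_sub, sub_eq_zero]
    exact fun h => ha (h.2.symm.trans h.1)
  rw [analyticOrderAt_deriv_toFun_eq]
  rcases mul_eq_zero.1 hx with h | h
  · rw [← sub_zero x] at h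
    rw [analyticOrderAt_sin h, analyticOrderAt_sin_eq_zero fun h' => hne ⟨h, h'⟩]
    rfl
  · rw [analyticOrderAt_sin h, analyticOrderAt_sin_eq_zero fun h' => hne ⟨h', h⟩]
    rfl

/-- A monotone map with a repeated value is constant on an interval, where its derivative would have
infinite order of vanishing. This includes the degenerate parameters `0` and `1`, needed as
endpoints of the intermediate value argument. -/
theorem bijective_lift (a : ℝ) : Function.Bijective (lift a) := by
  have hc : Continuous (lift a) :=
    continuous_iff_continuousAt.2 fun x => (analyticAt_toFun a x).continuousAt
  refine ⟨?_, (lift a).continuous_iff_surjective.1 hc⟩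
  intro x y he
  by_contra hne
  wlog hxy : x < y generalizing x y
  · exact this he.symm (Ne.symm hne) (lt_of_le_of_ne (not_lt.1 hxy) (Ne.symm hne))
  obtain ⟨z, hz⟩ := exists_between hxy
  refine analyticOrderAt_deriv_toFun_ne_top a z (analyticOrderAt_eq_top.2 ?_)
  filter_upwards [isOpen_Ioo.mem_nhds hz] with w hw
  have : toFun a =ᶠ[𝓝 w] fun _ => toFun a x := by
    filter_upwards [isOpen_Ioo.mem_nhds hw] with v hv
    exact le_antisymm ((monotone_toFun a hv.2.le).trans_eq he.symm) (monotone_toFun a hv.1.le)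
  rw [this.deriv_eq, deriv_const]

end Bicubic

/-! ### Arcs of the circle cut at two points. -/

/-- The components of a union of two disjoint open connected sets. -/
theorem circleComponents_union {A B : Set UnitAddCircle} (hA : IsOpen A) (hB : IsOpen B)
    (hAc : IsConnected A) (hBc : IsConnected B) (hAB : Disjoint A B) :
    circleComponents (A ∪ B) = {A, B} := by
  have hAx : ∀ x ∈ A, connectedComponentIn (A ∪ B) x = A := fun x hx =>
    (isPreconnected_connectedComponentIn.subset_left_of_subset_union hA hB hAB
      (connectedComponentIn_subset _ _) ⟨x, mem_connectedComponentIn (Or.inl hx), hx⟩).antisymm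
      (hAc.isPreconnected.subset_connectedComponentIn hx subset_union_left)
  have hBx : ∀ x ∈ B, connectedComponentIn (A ∪ B) x = B := fun x hx =>
    (isPreconnected_connectedComponentIn.subset_right_of_subset_union hA hB hAB
      (connectedComponentIn_subset _ _) ⟨x, mem_connectedComponentIn (Or.inr hx), hx⟩).antisymm
      (hBc.isPreconnected.subset_connectedComponentIn hx subset_union_right)
  ext C
  constructor
  · rintro ⟨x, hx | hx, rfl⟩
    · exact Or.inl (hAx x hx)
    · exact Or.inr (hBx x hx)
  · rintro (rfl | rfl)
    · obtain ⟨x, hx⟩ := hAc.nonempty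
      exact ⟨x, Or.inl hx, (hAx x hx).symm⟩
    · obtain ⟨x, hx⟩ := hBc.nonempty
      exact ⟨x, Or.inr hx, (hBx x hx).symm⟩

/-- Links the form of an arc used for measures with the one from which openness and connectedness
are read off. -/
theorem equivIco_arc_eq_image {u v : ℝ} (hu : 0 ≤ u) (hv : v ≤ 1) :
    {p : UnitAddCircle | (AddCircle.equivIco 1 0 p : ℝ) ∈ Ioo u v} =
      ((↑) : ℝ → UnitAddCircle) '' Ioo u v := by
  ext p
  constructor
  · exact fun hp => ⟨_, hp, AddCircle.coe_equivIco⟩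
  · rintro ⟨x, hx, rfl⟩
    have : x ∈ Ico (0 : ℝ) (0 + 1) := ⟨hu.trans hx.1.le, by linarith [hx.2]⟩
    rwa [mem_ofPred_eq, AddCircle.equivIco_coe_of_mem this]

/-- The components of the complement of two points of the circle. -/
theorem circleComponents_compl_pair {a : ℝ} (ha : a ∈ Ioo (0 : ℝ) 1) :
    {p : UnitAddCircle | (AddCircle.equivIco 1 0 p : ℝ) ∈ Ioo 0 a} ≠
      {p | (AddCircle.equivIco 1 0 p : ℝ) ∈ Ioo a 1} ∧
    circleComponents {(0 : UnitAddCircle), (a : UnitAddCircle)}ᶜ =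
      {{p | (AddCircle.equivIco 1 0 p : ℝ) ∈ Ioo 0 a},
        {p | (AddCircle.equivIco 1 0 p : ℝ) ∈ Ioo a 1}} := by
  set A := {p : UnitAddCircle | (AddCircle.equivIco 1 0 p : ℝ) ∈ Ioo 0 a} with hA
  set B := {p : UnitAddCircle | (AddCircle.equivIco 1 0 p : ℝ) ∈ Ioo a 1} with hB
  have hdisj : Disjoint A B := disjoint_left.2 fun p hp hp' => lt_asymm hp.2 hp'.1
  have hA' : A = ((↑) : ℝ → UnitAddCircle) '' Ioo 0 a := equivIco_arc_eq_image le_rfl ha.2.le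
  have hB' : B = ((↑) : ℝ → UnitAddCircle) '' Ioo a 1 := equivIco_arc_eq_image ha.1.le le_rfl
  have hcoe : Continuous ((↑) : ℝ → UnitAddCircle) := AddCircle.continuous_mk' 1
  have hopen : ∀ u v : ℝ, IsOpen (((↑) : ℝ → UnitAddCircle) '' Ioo u v) := fun u v =>
    QuotientAddGroup.isOpenMap_coe _ isOpen_Ioo
  have hAc : IsConnected A := by
    rw [hA']; exact (isConnected_Ioo ha.1).image _ hcoe.continuousOn
  have hBc : IsConnected B := by
    rw [hB']; exact (isConnected_Ioo ha.2).image _ hcoe.continuousOn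
  have hunion : {(0 : UnitAddCircle), (a : UnitAddCircle)}ᶜ = A ∪ B := by
    have h0 : ∀ p : UnitAddCircle, p = 0 ↔ (AddCircle.equivIco 1 0 p : ℝ) = 0 := by
      intro p
      constructor
      · rintro rfl
        exact AddCircle.equivIco_coe_of_mem (y := 0) (by simp)
      · intro h
        rw [← AddCircle.coe_equivIco (p := (1 : ℝ)) (a := 0) (y := p), h, AddCircle.coe_zero]
    have h1 : ∀ p : UnitAddCircle, p = (a : UnitAddCircle) ↔
        (AddCircle.equivIco 1 0 p : ℝ) = a := by
      intro p
      constructor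
      · rintro rfl
        exact AddCircle.equivIco_coe_of_mem ⟨ha.1.le, by simpa using ha.2⟩
      · intro h
        rw [← AddCircle.coe_equivIco (p := (1 : ℝ)) (a := 0) (y := p), h]
    ext p
    obtain ⟨hp0, hp1⟩ := IsCircleLift.equivIco_mem p
    simp only [mem_compl_iff, mem_insert_iff, mem_singleton_iff, h0, h1, not_or, mem_union, hA, hB,
      mem_ofPred_eq, mem_Ioo]
    constructor
    · rintro ⟨h0, h1⟩
      rcases lt_or_gt_of_ne h1 with h | h
      · exact Or.inl ⟨lt_of_le_of_ne hp0 (Ne.symm h0), h⟩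
      · exact Or.inr ⟨h, hp1⟩
    · rintro (h | h)
      · exact ⟨h.1.ne', h.2.ne⟩
      · exact ⟨(ha.1.trans h.1).ne', h.1.ne'⟩
  refine ⟨fun h => ?_, ?_⟩
  · obtain ⟨x, hx⟩ := hAc.nonempty
    exact disjoint_left.1 hdisj hx (h ▸ hx)
  · rw [hunion]
    exact circleComponents_union (hA' ▸ hopen _ _) (hB' ▸ hopen _ _) hAc hBc hdisj

/-! ### Critical points of the maps in the family. -/

namespace IsCircleLift

variable {F : CircleDeg1Lift} {f : UnitAddCircle ≃ₜ UnitAddCircle}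

theorem isCircleCriticalPoint_iff (hF : IsCircleLift F f) (c : UnitAddCircle) :
    IsCircleCriticalPoint f c ↔ ∃ x : ℝ, (x : UnitAddCircle) = c ∧ HasDerivAt F 0 x := by
  constructor
  · rintro ⟨G, x, hG, hx, hd⟩
    obtain ⟨m, hm⟩ := hF.exists_eq_add_int hG
    refine ⟨x, hx, ?_⟩
    rw [show (F : ℝ → ℝ) = fun y => G y + m from funext hm]
    exact hd.add_const _
  · rintro ⟨x, hx, hd⟩
    exact ⟨F, x, hF, hx, hd⟩

end IsCircleLift

namespace Bicubic

open Real

theorem hasDerivAt_shift (a t x : ℝ) : HasDerivAt ((lift a).shift t)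
    (4 / (cos (π * a) ^ 2 + 1 / 2) * (sin (π * x) * sin (π * (x - a))) ^ 2) x :=
  (hasDerivAt_toFun a x).const_add t

theorem hasDerivAt_shift_zero_iff (a t x : ℝ) : HasDerivAt ((lift a).shift t) 0 x ↔
    (x : UnitAddCircle) = 0 ∨ (x : UnitAddCircle) = (a : UnitAddCircle) := by
  rw [← sin_mul_sin_eq_zero_iff]
  have h := hasDerivAt_shift a t x
  constructor
  · intro h0
    have := h0.unique h
    have hN := (div_pos (by norm_num : (0 : ℝ) < 4) (denom_pos a)).ne'
    exact pow_eq_zero_iff two_ne_zero |>.1 ((mul_eq_zero.1 this.symm).resolve_left hN)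
  · intro h0
    simpa [h0] using h

theorem analyticAt_shift (a t x : ℝ) : AnalyticAt ℝ ((lift a).shift t) x :=
  analyticAt_const.add (analyticAt_toFun a x)

theorem contDiff_shift (a t : ℝ) (n : WithTop ℕ∞) : ContDiff ℝ n ((lift a).shift t) :=
  contDiff_iff_contDiffAt.2 fun x => (analyticAt_shift a t x).contDiffAt

variable {a t : ℝ} {f : UnitAddCircle ≃ₜ UnitAddCircle}

theorem setOf_isCircleCriticalPoint (hf : IsCircleLift ((lift a).shift t) f) :
    {c | IsCircleCriticalPoint f c} = {(0 : UnitAddCircle), (a : UnitAddCircle)} := by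
  ext c
  simp only [mem_ofPred_eq, hf.isCircleCriticalPoint_iff, hasDerivAt_shift_zero_iff]
  constructor
  · rintro ⟨x, rfl, h⟩
    exact h
  · rintro (rfl | rfl)
    · exact ⟨0, AddCircle.coe_zero _, Or.inl (AddCircle.coe_zero _)⟩
    · exact ⟨a, rfl, Or.inr rfl⟩

theorem isMulticriticalCircleMap (ha : (a : UnitAddCircle) ≠ 0)
    (hf : IsCircleLift ((lift a).shift t) f) : IsMulticriticalCircleMap f := by
  refine ⟨⟨_, hf, contDiff_shift a t 3⟩, ?_, ?_, fun c hc => ⟨3, by norm_num, ?_⟩⟩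
  · rw [setOf_isCircleCriticalPoint hf]
    exact toFinite _
  · rw [setOf_isCircleCriticalPoint hf]
    exact insert_nonempty _ _
  · obtain ⟨x, hx, hd⟩ := (hf.isCircleCriticalPoint_iff c).1 hc
    have hd' := (sin_mul_sin_eq_zero_iff a x).2 ((hasDerivAt_shift_zero_iff a t x).1 hd)
    have hderiv : deriv ((lift a).shift t) = deriv (toFun a) := by
      rw [deriv_toFun]
      exact funext fun y => (hasDerivAt_shift a t y).deriv
    obtain ⟨φ, h1, h2, h3, h4, h5⟩ :=
      (analyticAt_shift a t x).exists_openPartialHomeomorph_cube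
        (by rw [hderiv, analyticOrderAt_deriv_toFun ha hd']) ((lift a).shift t).monotone
    exact ⟨_, x, φ, hf, hx, h1, h2, h3, h4, h5⟩

end Bicubic

/-! ### Choice of the parameter and conclusion. -/

theorem mainTheorem10 (ρ α : ℝ) (hρ : ρ ∈ Set.Icc (0 : ℝ) 1) (hirr : Irrational ρ)
    (hα : α ∈ Set.Ioo (0 : ℝ) 1) : IsAdmissiblePair ρ α := by
  obtain ⟨t, ht, hτ⟩ := CircleDeg1Lift.exists_continuous_shift_translationNumber_eq hirr
    Bicubic.continuous_lift Bicubic.bijective_lift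
  have hbij : ∀ a, Function.Bijective ((Bicubic.lift a).shift (t a)) := fun a =>
    CircleDeg1Lift.bijective_shift (Bicubic.bijective_lift a) _
  -- The choice is made independently for each `a`; only the increments of `h a` turn out to be
  -- continuous in `a`.
  choose h hh using fun a => CircleDeg1Lift.exists_semiconj_translate (hbij a) (hτ a)
  have hcont : Continuous fun a => h a a - h a 0 :=
    CircleDeg1Lift.continuous_semiconj_sub hirr
      (CircleDeg1Lift.continuous_shift_family Bicubic.continuous_lift ht) hh continuous_id
  obtain ⟨a, ha, hha⟩ : ∃ a ∈ Ioo (0 : ℝ) 1, h a a - h a 0 = α := by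
    refine intermediate_value_Ioo zero_le_one hcont.continuousOn ?_
    have : h 1 1 - h 1 0 = 1 := by
      have := (h 1).map_add_one 0
      rw [zero_add] at this
      linarith
    rwa [this, sub_self]
  have ha0 : (a : UnitAddCircle) ≠ 0 := by
    rw [← AddCircle.coe_zero, Ne, AddCircle.coe_eq_coe_iff_of_mem_Ico (p := (1 : ℝ)) (a := 0)
      ⟨ha.1.le, by simpa using ha.2⟩ (by simp)]
    exact ha.1.ne'
  obtain ⟨f, hf⟩ := CircleDeg1Lift.exists_isCircleLift (hbij a)
  obtain ⟨g, hg⟩ := CircleDeg1Lift.exists_translate_semiconj (hbij a) (hτ a)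
  have : IsProbabilityMeasure (volume : Measure UnitAddCircle) := ⟨UnitAddCircle.measure_univ⟩
  have hprob : IsProbabilityMeasure ((volume : Measure UnitAddCircle).map g.circleMap) :=
    Measure.isProbabilityMeasure_map g.measurable_circleMap.aemeasurable
  have hinv := hf.map_map_circleMap hg
  obtain ⟨hne, hcomp⟩ := circleComponents_compl_pair ha
  refine ⟨f, Bicubic.isMulticriticalCircleMap ha0 hf, ⟨_, hf, Bicubic.contDiff_shift a _ _⟩, ?_,
    _, ⟨hprob, hinv, fun ν hν hνf => hf.measure_unique hirr (hh a) hinv hνf⟩,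
    0, a, ha0.symm, Bicubic.setOf_isCircleCriticalPoint hf, _, _, hne, hcomp, ?_, ?_⟩
  -- The fractional part is harmless, since irrationality excludes `ρ = 1`.
  · rw [hf.circleRotationNumber_eq, hτ a, Int.fract_eq_self]
    exact ⟨hρ.1, lt_of_le_of_ne hρ.2 hirr.ne_one⟩
  · rw [hf.measureReal_arc hirr (hh a) hinv ⟨ha.1.le, ha.2.le⟩, hha]
  · rw [hf.measureReal_arc_compl hirr (hh a) hinv ⟨ha.1.le, ha.2.le⟩, hha]
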